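/- Let $c=\{c_k\}_{k\in\mathbb Z}$ be a sequence of complex numbers with $\lim_{|k|\to\infty}c_k=0$ and $\sum_{k=-\infty}^{\infty}|c_k-c_{k+1}|<\infty$ (that is, $c$ is a null-sequence of bounded variation, $c\in bv$). For a sequence $a=\{a_k\}_{k\in\mathbb Z}$, its discrete Hilbert transform $ha=\{ha_n\}_{n\in\mathbb Z}$ is $$ha_n=\sum_{k=-\infty}^{\infty}\frac{a_k}{n+\frac12-k}=\lim_{N\to\infty}\sum_{k=-N}^{N}\frac{a_k}{n+\frac12-k},$$ and it is said to exist if this limit exists for every $n\in\mathbb Z$ (as it does, absolutely, when $a$ is summable). Suppose that at least one of the following two conditions holds: 1) the discrete Hilbert transform of the sequence of differences $d=\{d_k\}$, $d_k=c_{k+1}-c_k$, is summable: $\sum_{n=-\infty}^{\infty}|hd_n|<\infty$; 2) the discrete Hilbert transform $hc$ exists and is of bounded variation: $\sum_{n=-\infty}^{\infty}|hc_n-hc_{n+1}|<\infty$. Then the series $\sum_{k=-\infty}^{\infty}c_ke^{ikt}$ is a Fourier series, that is, there is an integrable, $2\pi$-periodic function $f\in L_1([-\pi,\pi))$ such that $c_k=\frac1{2\pi}\int_{-\pi}^{\pi}f(t)e^{-ikt}\,dt$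 for all $k\in\mathbb Z$. -/

import Mathlib

open Filter Topology

/-- A two-sided sequence is a null-sequence if `c k → 0` as `|k| → ∞`. -/
def IsNullSeq (c : ℤ → ℂ) : Prop :=
  Tendsto c cofinite (𝓝 0)

/-- `c ∈ bv`: the differences of consecutive terms are absolutely summable. -/
def IsBV (c : ℤ → ℂ) : Prop :=
  Summable fun k : ℤ => ‖c k - c (k + 1)‖

/-- The discrete Hilbert transform of `c` exists and equals `h`: for every integer `n` the series
`∑_{k=-∞}^{∞} c k / (n + 1/2 - k)` converges to `h n`, the sum being the limit of the symmetric
partial sums (for summable `c` the series converges absolutely and this is its usual sum). -/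
def HasDiscreteHilbertTransform (c h : ℤ → ℂ) : Prop :=
  ∀ n : ℤ, Tendsto
    (fun N : ℕ => ∑ k ∈ Finset.Icc (-(N : ℤ)) (N : ℤ), c k / ((n : ℂ) + 1 / 2 - (k : ℂ)))
    atTop (𝓝 (h n))

/-- The series `∑ c k * exp (i k t)` is a Fourier series: there is an integrable function on the
circle `ℝ / 2πℤ` whose `k`-th Fourier coefficient (with respect to normalized Lebesgue measure)
is `c k` for every integer `k`. -/
def IsFourierSeries (c : ℤ → ℂ) : Prop :=
  haveI : Fact (0 < 2 * Real.pi) := ⟨Real.two_pi_pos⟩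
  ∃ f : AddCircle (2 * Real.pi) → ℂ,
    MeasureTheory.Integrable f AddCircle.haarAddCircle ∧ ∀ k : ℤ, fourierCoeff f k = c k

/-! Put d_k = c_{k+1} - c_k and D(t) = ∑ d_k e^{ikt}. Then D is continuous, and D(0) = 0 because the
sum of d telescopes. Formally D = (e^{-it} - 1) ∑ c_k e^{ikt}, so the candidate is f = D / (e^{-it}
- 1). Once f is integrable, f e^{-it} = f + D shows that the Fourier coefficients of f have the same
differences as c, and Riemann–Lebesgue together with c → 0 makes them equal to c. The whole
difficulty is the integrability of D(t)/t near 0.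

The sequence hd consists of the Fourier coefficients of S(t) = iπ sgn(t) e^{-it/2} D(t)
(`hasSum_fourierCoeff_squareWaveMul`). If hd is summable, then D ± e^{it/2} S/(iπ) is an absolutely
convergent sum of exponentials that, near 0, vanishes on one side and equals 2D on the other. A
local Hardy inequality (`lintegral_div_lt_top_of_vanishing`) makes such a function integrable
against ds/s. It comes from sampling at the points m/N: the Fejér mean of the samples is an analytic
polynomial whose L¹ norm is at most the sum of the moduli of the coefficients, so `hardy_inequality`
applies uniformly in N, and Fatou gives the limit. Hardy's inequality itself follows from Hilbert's
inequality and a factorization f = GK.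

Condition 2 reduces to condition 1, since the transform commutes with differences
(`HasDiscreteHilbertTransform.sub_shift`). -/

/-! ### Hilbert's inequality. -/

/-- Each new term is at most the increment of the right-hand side. Only the uniform bound 8 is
needed later; the N-dependent form is what lets the induction close. -/
theorem sum_hilbert_kernel_le (j N : ℕ) :
    ∑ k ∈ Finset.range N, √((j : ℝ) + 1) / (√((k : ℝ) + 1) * ((j : ℝ) + k + 1)) ≤
      8 * √(N : ℝ) / (√(N : ℝ) + √((j : ℝ) + 1)) := by
  induction N with
  | zero => simp
  | succ n ih =>
    rw [Finset.sum_range_succ]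
    have hb1 : 1 ≤ √((j : ℝ) + 1) := Real.one_le_sqrt.2 (by linarith [Nat.cast_nonneg (α := ℝ) j])
    have hb2 : √((j : ℝ) + 1) ^ 2 = j + 1 := Real.sq_sqrt (by positivity)
    have ha2 : √(n : ℝ) ^ 2 = n := Real.sq_sqrt (by positivity)
    have ha'2 : √((n : ℝ) + 1) ^ 2 = n + 1 := Real.sq_sqrt (by positivity)
    have ha : 0 ≤ √(n : ℝ) := Real.sqrt_nonneg _
    have ha' : 0 < √((n : ℝ) + 1) := Real.sqrt_pos.2 (by positivity)
    have haa : √(n : ℝ) ≤ √((n : ℝ) + 1) := Real.sqrt_le_sqrt (by linarith)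
    push_cast
    have hden : (j : ℝ) + n + 1 = √((j : ℝ) + 1) ^ 2 + √(n : ℝ) ^ 2 := by rw [hb2, ha2]; ring
    rw [hden]
    have hd : √((n : ℝ) + 1) ^ 2 = √(n : ℝ) ^ 2 + 1 := by rw [ha'2, ha2]
    generalize √((j : ℝ) + 1) = b at *
    generalize √(n : ℝ) = a at *
    generalize √((n : ℝ) + 1) = a' at *
    have key : b / (a' * (b ^ 2 + a ^ 2)) ≤ 8 * a' / (a' + b) - 8 * a / (a + b) := by
      have h1 : 8 * a' / (a' + b) - 8 * a / (a + b) = 8 * b * (a' - a) / ((a' + b) * (a + b)) := by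
        field_simp
        ring
      -- This is a' - a = 1 / (a' + a) ≥ 1 / (2a').
      have h2 : 1 ≤ (a' - a) * (2 * a') := by nlinarith
      have h3 : a' ≤ a + 1 := by nlinarith
      have h4 : (a' + b) * (a + b) ≤ 4 * (b ^ 2 + a ^ 2) := by nlinarith [sq_nonneg (a - b)]
      rw [h1, div_le_div_iff₀ (by positivity) (by positivity)]
      calc b * ((a' + b) * (a + b)) ≤ b * (4 * (b ^ 2 + a ^ 2)) * 1 := by
            rw [mul_one]; gcongr
        _ ≤ b * (4 * (b ^ 2 + a ^ 2)) * ((a' - a) * (2 * a')) := by gcongr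
        _ = _ := by ring
    linarith

/-- Hilbert's inequality for finite sections, with the right-hand side in additive form. -/
theorem hilbert_inequality (x y : ℕ → ℝ) (N : ℕ) :
    ∑ j ∈ Finset.range N, ∑ k ∈ Finset.range N, x j * y k / ((j : ℝ) + k + 1) ≤
      4 * ∑ j ∈ Finset.range N, x j ^ 2 + 4 * ∑ k ∈ Finset.range N, y k ^ 2 := by
  have row : ∀ j : ℕ, ∑ k ∈ Finset.range N,
      √((j : ℝ) + 1) / (√((k : ℝ) + 1) * ((j : ℝ) + k + 1)) ≤ 8 := fun j => by
    refine (sum_hilbert_kernel_le j N).trans ?_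
    have : 0 < √((j : ℝ) + 1) := Real.sqrt_pos.2 (by positivity)
    rw [div_le_iff₀ (by positivity)]
    linarith
  -- Schur test with weights √(j+1): the two sides differ by a perfect square over a positive
  -- quantity.
  have amgm : ∀ j k : ℕ, x j * y k / ((j : ℝ) + k + 1) ≤
      x j ^ 2 / 2 * (√((j : ℝ) + 1) / (√((k : ℝ) + 1) * ((j : ℝ) + k + 1))) +
      y k ^ 2 / 2 * (√((k : ℝ) + 1) / (√((j : ℝ) + 1) * ((k : ℝ) + j + 1))) := fun j k => by
    have hp : 0 < √((j : ℝ) + 1) := Real.sqrt_pos.2 (by positivity)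
    have hq : 0 < √((k : ℝ) + 1) := Real.sqrt_pos.2 (by positivity)
    rw [add_comm (k : ℝ) (j : ℝ)]
    have hs : (0 : ℝ) < (j : ℝ) + k + 1 := by positivity
    generalize √((j : ℝ) + 1) = p at *
    generalize √((k : ℝ) + 1) = q at *
    generalize (j : ℝ) + k + 1 = s at *
    have : x j ^ 2 / 2 * (p / (q * s)) + y k ^ 2 / 2 * (q / (p * s)) - x j * y k / s =
        (x j * p - y k * q) ^ 2 / (2 * p * q * s) := by
      field_simp
      ring
    have h2 : 0 ≤ (x j * p - y k * q) ^ 2 / (2 * p * q * s) := by positivity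
    linarith
  calc _ ≤ ∑ j ∈ Finset.range N, ∑ k ∈ Finset.range N, (_ + _) :=
        Finset.sum_le_sum fun j _ => Finset.sum_le_sum fun k _ => amgm j k
    _ = ∑ j ∈ Finset.range N, x j ^ 2 / 2 * ∑ k ∈ Finset.range N,
          √((j : ℝ) + 1) / (√((k : ℝ) + 1) * ((j : ℝ) + k + 1)) +
        ∑ k ∈ Finset.range N, y k ^ 2 / 2 * ∑ j ∈ Finset.range N,
          √((k : ℝ) + 1) / (√((j : ℝ) + 1) * ((k : ℝ) + j + 1)) := by
        simp_rw [Finset.sum_add_distrib, Finset.mul_sum]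
        congr 1
        exact Finset.sum_comm
    _ ≤ ∑ j ∈ Finset.range N, x j ^ 2 / 2 * 8 + ∑ k ∈ Finset.range N, y k ^ 2 / 2 * 8 := by
        gcongr with j _ k _
        · exact row j
        · exact row k
    _ = _ := by
        rw [Finset.mul_sum, Finset.mul_sum]
        congr 1 <;> exact Finset.sum_congr rfl fun _ _ => by ring

/-! ### Hardy's inequality in the disc algebra. -/

section Hardy

open MeasureTheory AddCircle

variable {T : ℝ}

variable (T) in
/-- The disc algebra: uniform limits of polynomials in `fourier 1`. -/
noncomputable def discAlgebra : Subalgebra ℂ C(AddCircle T, ℂ) :=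
  (Algebra.adjoin ℂ {fourier 1}).topologicalClosure

theorem fourier_natCast_eq_pow (k : ℕ) : (fourier k : C(AddCircle T, ℂ)) = fourier 1 ^ k := by
  induction k with
  | zero => ext x; simp
  | succ k ih =>
    ext x
    rw [pow_succ, ← ih]
    push_cast
    exact fourier_add

theorem fourier_natCast_mem_discAlgebra (k : ℕ) : fourier (k : ℤ) ∈ discAlgebra T := by
  rw [fourier_natCast_eq_pow]
  exact pow_mem (Subalgebra.le_topologicalClosure _ (Algebra.self_mem_adjoin_singleton _ _)) _

theorem isClosed_discAlgebra : IsClosed (discAlgebra T : Set C(AddCircle T, ℂ)) :=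
  Subalgebra.isClosed_topologicalClosure _

/-- By linearity and continuity, identities between functionals need checking only on the powers of
`fourier 1`. -/
theorem eqOn_discAlgebra {L₁ L₂ : C(AddCircle T, ℂ) →L[ℂ] ℂ}
    (h : ∀ k : ℕ, L₁ (fourier k) = L₂ (fourier k)) {f : C(AddCircle T, ℂ)}
    (hf : f ∈ discAlgebra T) : L₁ f = L₂ f := by
  have hs : Set.EqOn L₁ L₂ (Algebra.adjoin ℂ {(fourier 1 : C(AddCircle T, ℂ))}) := by
    intro g hg
    rw [SetLike.mem_coe, Algebra.adjoin_singleton_eq_range_aeval] at hg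
    obtain ⟨p, rfl⟩ := hg
    simp only [AlgHom.toRingHom_eq_coe, RingHom.coe_coe, Polynomial.aeval_eq_sum_range, map_sum,
      map_smul, ← fourier_natCast_eq_pow, h]
  exact hs.closure L₁.continuous L₂.continuous hf

theorem exp_mem_discAlgebra {W : C(AddCircle T, ℂ)} (hW : W ∈ discAlgebra T) :
    NormedSpace.exp W ∈ discAlgebra T := by
  rw [NormedSpace.exp_eq_tsum ℂ]
  exact tsum_mem isClosed_discAlgebra fun i => Subalgebra.smul_mem _ (pow_mem hW _) _

variable [hT : Fact (0 < T)]

theorem integrable_haarAddCircle_of_continuous {E : Type*} [NormedAddCommGroup E]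
    {f : AddCircle T → E} (hf : Continuous f) : Integrable f haarAddCircle :=
  hf.integrable_of_hasCompactSupport (HasCompactSupport.of_compactSpace f)

/-- The `n`-th Fourier coefficient as a continuous linear functional on continuous functions. -/
noncomputable def fourierCoeffCLM (n : ℤ) : C(AddCircle T, ℂ) →L[ℂ] ℂ :=
  LinearMap.mkContinuous
    { toFun := fun f => fourierCoeff f n
      map_add' := fun f g => by
        have := congrFun (fourierCoeff.add (integrable_haarAddCircle_of_continuous f.continuous)
          (integrable_haarAddCircle_of_continuous g.continuous)) n
        simpa using this
      map_smul' := fun c f => by simpa using fourierCoeff.const_smul f c n } 1 fun f => by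
    refine (norm_integral_le_of_norm_le_const (C := ‖f‖) (.of_forall fun x => ?_)).trans ?_
    · rw [norm_smul, fourier_apply, Circle.norm_coe, one_mul]
      exact f.norm_coe_le_norm x
    · simp

theorem fourierCoeffCLM_apply (n : ℤ) (f : C(AddCircle T, ℂ)) :
    fourierCoeffCLM n f = fourierCoeff f n := rfl

theorem fourierCoeff_mul_fourier (g : AddCircle T → ℂ) (m n : ℤ) :
    fourierCoeff (fun x => g x * fourier m x) n = fourierCoeff g (n - m) := by
  refine integral_congr_ae (.of_forall fun x => ?_)
  simp only [smul_eq_mul]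
  rw [show -(n - m) = -n + m by ring, fourier_add]
  ring

/-- Finite Bessel inequality for the nonnegative Fourier coefficients. -/
theorem sum_sq_fourierCoeff_le (f : C(AddCircle T, ℂ)) (N : ℕ) :
    ∑ n ∈ Finset.range N, ‖fourierCoeff f n‖ ^ 2 ≤ ∫ x, ‖f x‖ ^ 2 ∂haarAddCircle := by
  have h := hasSum_sq_fourierCoeff (ContinuousMap.toLp (E := ℂ) 2 haarAddCircle ℂ f)
  simp_rw [fourierCoeff_toLp] at h
  have h1 := sum_le_hasSum ((Finset.range N).map Nat.castEmbedding) (fun _ _ => by positivity) h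
  rw [Finset.sum_map] at h1
  refine h1.trans_eq (integral_congr_ae ?_)
  filter_upwards [ContinuousMap.coeFn_toLp (p := 2) haarAddCircle (𝕜 := ℂ) f] with x hx
  rw [hx]

theorem fourierCoeff_neg_of_mem_discAlgebra {f : C(AddCircle T, ℂ)} (hf : f ∈ discAlgebra T)
    {n : ℤ} (hn : n < 0) : fourierCoeff f n = 0 := by
  refine eqOn_discAlgebra (L₁ := fourierCoeffCLM n) (L₂ := 0) (fun k => ?_) hf
  rw [fourierCoeffCLM_apply, fourierCoeff_fourier]
  exact Pi.single_eq_of_ne (by omega) _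

theorem fourierCoeff_mul_of_mem_discAlgebra {f g : C(AddCircle T, ℂ)} (hf : f ∈ discAlgebra T)
    (hg : g ∈ discAlgebra T) (n : ℕ) :
    fourierCoeff (f * g : C(AddCircle T, ℂ)) n =
      ∑ p ∈ Finset.HasAntidiagonal.antidiagonal n, fourierCoeff f p.1 * fourierCoeff g p.2 := by
  have := eqOn_discAlgebra
    (L₁ := (fourierCoeffCLM n).comp (ContinuousLinearMap.mul ℂ C(AddCircle T, ℂ) f))
    (L₂ := ∑ p ∈ Finset.HasAntidiagonal.antidiagonal n, fourierCoeff f p.1 • fourierCoeffCLM p.2)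
    (fun k => ?_) hg
  · simpa [fourierCoeffCLM_apply, sum_apply] using this
  · simp only [ContinuousLinearMap.comp_apply, ContinuousLinearMap.mul_apply', fourierCoeffCLM_apply,
      sum_apply, smul_apply, fourierCoeff_fourier,
      smul_eq_mul]
    rw [show ⇑(f * fourier (k : ℤ) : C(AddCircle T, ℂ)) = fun x => f x * fourier (k : ℤ) x from rfl,
      fourierCoeff_mul_fourier]
    by_cases hk : k ≤ n
    · rw [Finset.sum_eq_single (n - k, k)]
      · simp [Nat.cast_sub hk]
      · intro p hp hne
        rw [Pi.single_eq_of_ne, mul_zero]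
        intro h
        apply hne
        rw [Finset.HasAntidiagonal.mem_antidiagonal] at hp
        ext <;> simp <;> omega
      · intro h
        exact absurd (Finset.HasAntidiagonal.mem_antidiagonal.2 (by simp; omega)) h
    · rw [fourierCoeff_neg_of_mem_discAlgebra hf (by omega), Finset.sum_eq_zero]
      intro p hp
      rw [Finset.HasAntidiagonal.mem_antidiagonal] at hp
      rw [Pi.single_eq_of_ne (by omega), mul_zero]

theorem exists_add_star_discAlgebra {q : C(AddCircle T, ℂ)}
    (hq : q ∈ Submodule.span ℂ (Set.range (fourier (T := T)))) :
    ∃ U ∈ discAlgebra T, ∃ V ∈ discAlgebra T, q = U + star V := by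
  induction hq using Submodule.span_induction with
  | mem x hx =>
    obtain ⟨n, rfl⟩ := hx
    obtain ⟨k, rfl | rfl⟩ := n.eq_nat_or_neg
    · exact ⟨_, fourier_natCast_mem_discAlgebra k, 0, zero_mem _, by simp⟩
    · refine ⟨0, zero_mem _, _, fourier_natCast_mem_discAlgebra k, ?_⟩
      ext x
      simpa using fourier_neg (n := (k : ℤ)) (x := x)
  | zero => exact ⟨0, zero_mem _, 0, zero_mem _, by simp⟩
  | add x y _ _ hx hy =>
    obtain ⟨U, hU, V, hV, rfl⟩ := hx
    obtain ⟨U', hU', V', hV', rfl⟩ := hy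
    exact ⟨U + U', add_mem hU hU', V + V', add_mem hV hV', by rw [star_add]; abel⟩
  | smul c x _ hx =>
    obtain ⟨U, hU, V, hV, rfl⟩ := hx
    exact ⟨c • U, Subalgebra.smul_mem _ hU _, star c • V, Subalgebra.smul_mem _ hV _, by
      rw [star_smul, star_star, smul_add]⟩

/-- Real parts of the disc algebra are uniformly dense in the real continuous functions. -/
theorem exists_discAlgebra_re_near (u : C(AddCircle T, ℝ)) :
    ∃ U ∈ discAlgebra T, ∀ x, |(U x).re - u x| ≤ 1 := by
  let v : C(AddCircle T, ℂ) := ⟨fun x => (u x : ℂ), by fun_prop⟩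
  have hv : v ∈ closure (Submodule.span ℂ (Set.range (fourier (T := T))) : Set _) := by
    rw [← Submodule.topologicalClosure_coe, span_fourier_closure_eq_top]
    trivial
  obtain ⟨q, hq, hdist⟩ := Metric.mem_closure_iff.1 hv 1 one_pos
  obtain ⟨U, hU, V, hV, rfl⟩ := exists_add_star_discAlgebra hq
  -- Conjugation preserves real parts, so U + V has the real part of q and lies in the algebra.
  refine ⟨U + V, add_mem hU hV, fun x => ?_⟩
  have h1 : ((U + V) x).re - u x = ((U + star V - v) x).re := by simp [v]
  rw [h1]
  refine (Complex.abs_re_le_norm _).trans (((U + star V - v).norm_coe_le_norm x).trans ?_)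
  rw [← dist_eq_norm, dist_comm]
  exact hdist.le

theorem ContinuousMap.exp_apply_complex {X : Type*} [TopologicalSpace X] [CompactSpace X]
    (f : C(X, ℂ)) (x : X) : (NormedSpace.exp f) x = Complex.exp (f x) := by
  rw [Complex.exp_eq_exp_ℂ]
  exact NormedSpace.map_exp (ContinuousMap.evalAlgHom ℂ ℂ x)
    (ContinuousEvalConst.continuous_eval_const x) f

theorem sum_mul_antidiagonal_div_le {x y : ℕ → ℝ} (hx : ∀ j, 0 ≤ x j) (hy : ∀ j, 0 ≤ y j) (N : ℕ) :
    ∑ n ∈ Finset.range N, (∑ p ∈ Finset.HasAntidiagonal.antidiagonal n, x p.1 * y p.2) / ((n : ℝ) + 1) ≤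
      ∑ j ∈ Finset.range N, ∑ k ∈ Finset.range N, x j * y k / ((j : ℝ) + k + 1) := by
  rw [← Finset.sum_product']
  set s := (Finset.range N ×ˢ Finset.range N).filter fun p => p.1 + p.2 < N
  calc _ = ∑ n ∈ Finset.range N, ∑ p ∈ s with p.1 + p.2 = n,
          x p.1 * y p.2 / ((p.1 : ℝ) + p.2 + 1) := by
        refine Finset.sum_congr rfl fun n hn => ?_
        rw [Finset.mem_range] at hn
        rw [Finset.sum_div]
        refine Finset.sum_congr ?_ fun p hp => ?_
        · ext p
          simp [s]
          omega
        · rw [← (Finset.mem_filter.1 hp).2]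
          push_cast
          rfl
    _ = ∑ p ∈ s, x p.1 * y p.2 / ((p.1 : ℝ) + p.2 + 1) :=
        Finset.sum_fiberwise_of_maps_to (fun p hp => by simpa using (Finset.mem_filter.1 hp).2) _
    _ ≤ _ := Finset.sum_le_sum_of_subset_of_nonneg (Finset.filter_subset _ _) fun p _ _ =>
        div_nonneg (mul_nonneg (hx _) (hy _)) (by positivity)

/-- A function in the disc algebra is a product of two functions of the disc algebra whose squared
moduli are controlled by its modulus. -/
theorem exists_discAlgebra_factorization {f : C(AddCircle T, ℂ)} (hf : f ∈ discAlgebra T) {δ : ℝ}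
    (hδ : 0 < δ) : ∃ G ∈ discAlgebra T, ∃ K ∈ discAlgebra T, f = G * K ∧
      (∀ x, ‖G x‖ ^ 2 ≤ Real.exp 1 * (‖f x‖ + δ)) ∧ ∀ x, ‖K x‖ ^ 2 ≤ Real.exp 1 * ‖f x‖ := by
  have hpos : ∀ x, 0 < ‖f x‖ + δ := fun x => by positivity
  -- G = exp(U/2) imitates an outer function with |G|² ≈ |f| + δ. It has no zeros, so K = f/G stays
  -- in the algebra; δ keeps the logarithm finite at zeros of f, and the error 1 in Re U costs the
  -- factor e.
  obtain ⟨U, hU, hUnear⟩ := exists_discAlgebra_re_near (T := T)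
    ⟨fun x => Real.log (‖f x‖ + δ),
      Continuous.log (by fun_prop) fun x => (hpos x).ne'⟩
  simp only [ContinuousMap.coe_mk] at hUnear
  have hUs : (1 / 2 : ℂ) • U ∈ discAlgebra T := Subalgebra.smul_mem _ hU _
  have hre : ∀ x, (((1 / 2 : ℂ) • U) x).re = (U x).re / 2 := fun x => by
    rw [ContinuousMap.smul_apply, smul_eq_mul]
    simp
    ring
  generalize (1 / 2 : ℂ) • U = W at hUs hre
  refine ⟨NormedSpace.exp W, exp_mem_discAlgebra hUs,
    f * NormedSpace.exp (-W),
    mul_mem hf (exp_mem_discAlgebra (neg_mem hUs)), ?_, ?_, ?_⟩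
  · ext x
    rw [ContinuousMap.mul_apply, ContinuousMap.mul_apply, ContinuousMap.exp_apply_complex,
      ContinuousMap.exp_apply_complex, ContinuousMap.neg_apply]
    rw [mul_left_comm, ← Complex.exp_add, add_neg_cancel, Complex.exp_zero, mul_one]
  · intro x
    rw [ContinuousMap.exp_apply_complex, Complex.norm_exp, ← Real.exp_nat_mul, hre,
      ← Real.exp_log (hpos x), ← Real.exp_add]
    refine Real.exp_le_exp.2 ?_
    have := (abs_le.1 (hUnear x)).2
    push_cast
    linarith
  · intro x
    have h2 : Real.exp (-(U x).re) ≤ Real.exp 1 / (‖f x‖ + δ) := by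
      have : Real.exp 1 / (‖f x‖ + δ) = Real.exp (1 - Real.log (‖f x‖ + δ)) := by
        rw [Real.exp_sub, Real.exp_log (hpos x)]
      rw [this]
      exact Real.exp_le_exp.2 (by linarith [(abs_le.1 (hUnear x)).1])
    rw [ContinuousMap.mul_apply, norm_mul, ContinuousMap.exp_apply_complex, Complex.norm_exp,
      mul_pow, ← Real.exp_nat_mul, ContinuousMap.neg_apply, Complex.neg_re, hre]
    calc _ = ‖f x‖ ^ 2 * Real.exp (-(U x).re) := by
          congr 2
          push_cast
          ring
      _ ≤ ‖f x‖ ^ 2 * (Real.exp 1 / (‖f x‖ + δ)) := by gcongr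
      _ = Real.exp 1 * ‖f x‖ * (‖f x‖ / (‖f x‖ + δ)) := by ring
      _ ≤ Real.exp 1 * ‖f x‖ * 1 := by
        have := (div_le_one (hpos x)).2 (by linarith : ‖f x‖ ≤ ‖f x‖ + δ)
        gcongr
      _ = _ := mul_one _

/-- Hardy's inequality for functions of the disc algebra. -/
theorem hardy_inequality {f : C(AddCircle T, ℂ)} (hf : f ∈ discAlgebra T) (N : ℕ) :
    ∑ n ∈ Finset.range N, ‖fourierCoeff f n‖ / ((n : ℝ) + 1) ≤
      8 * Real.exp 1 * ∫ x, ‖f x‖ ∂haarAddCircle := by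
  refine le_of_forall_pos_le_add fun ε hε => ?_
  obtain ⟨δ, hδ, hδε⟩ : ∃ δ : ℝ, 0 < δ ∧ 4 * Real.exp 1 * δ = ε :=
    ⟨ε / (4 * Real.exp 1), by positivity, by field_simp⟩
  obtain ⟨G, hGm, K, hKm, hGK, hGx, hKx⟩ := exists_discAlgebra_factorization hf hδ
  have hint : ∀ g : C(AddCircle T, ℂ), Integrable (fun x => ‖g x‖) (haarAddCircle (T := T)) :=
    fun g => integrable_haarAddCircle_of_continuous (by fun_prop)
  have hint2 : ∀ g : C(AddCircle T, ℂ), Integrable (fun x => ‖g x‖ ^ 2) (haarAddCircle (T := T)) :=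
    fun g => integrable_haarAddCircle_of_continuous (by fun_prop)
  have hGI : ∫ x, ‖G x‖ ^ 2 ∂haarAddCircle ≤
      Real.exp 1 * ((∫ x, ‖f x‖ ∂haarAddCircle) + δ) := by
    refine (integral_mono (hint2 G) (((hint f).add (integrable_const δ)).const_mul _) hGx).trans_eq ?_
    rw [integral_const_mul]
    congr 1
    simpa using integral_add (hint f) (integrable_const δ)
  have hKI : ∫ x, ‖K x‖ ^ 2 ∂haarAddCircle ≤ Real.exp 1 * ∫ x, ‖f x‖ ∂haarAddCircle := by
    refine (integral_mono (hint2 K) ((hint f).const_mul _) hKx).trans_eq ?_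
    rw [integral_const_mul]
  -- The coefficients of GK are convolutions. Hilbert's inequality passes to sums of squares, and
  -- Bessel to integrals; the constant is 8 = 4 + 4.
  calc ∑ n ∈ Finset.range N, ‖fourierCoeff f n‖ / ((n : ℝ) + 1)
      ≤ ∑ n ∈ Finset.range N, (∑ p ∈ Finset.HasAntidiagonal.antidiagonal n,
          ‖fourierCoeff G p.1‖ * ‖fourierCoeff K p.2‖) / ((n : ℝ) + 1) := by
        gcongr with n _
        have : fourierCoeff f n = _ :=
          (congrArg (fun g : C(AddCircle T, ℂ) => fourierCoeff g n) hGK).trans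
            (fourierCoeff_mul_of_mem_discAlgebra hGm hKm n)
        rw [this]
        exact (norm_sum_le _ _).trans_eq (Finset.sum_congr rfl fun _ _ => norm_mul _ _)
    _ ≤ _ := sum_mul_antidiagonal_div_le (x := fun n => ‖fourierCoeff G n‖)
        (y := fun n => ‖fourierCoeff K n‖) (fun _ => norm_nonneg _) (fun _ => norm_nonneg _) N
    _ ≤ _ := hilbert_inequality _ _ N
    _ ≤ 4 * (Real.exp 1 * ((∫ x, ‖f x‖ ∂haarAddCircle) + δ)) +
        4 * (Real.exp 1 * ∫ x, ‖f x‖ ∂haarAddCircle) := by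
        gcongr
        · exact (sum_sq_fourierCoeff_le G N).trans hGI
        · exact (sum_sq_fourierCoeff_le K N).trans hKI
    _ = _ := by rw [← hδε]; ring

end Hardy

/-! ### Fejér means of samples and a local Hardy inequality on the line. -/

section Sampling

open MeasureTheory AddCircle

variable {T : ℝ}

theorem sq_norm_sum_fourier (w : Circle) (N : ℕ) (x : AddCircle T) :
    ((‖∑ p ∈ Finset.range N, ((w ^ p : Circle) : ℂ) * fourier (T := T) p x‖ ^ 2 : ℝ) : ℂ) =
      ∑ p ∈ Finset.range N, ∑ q ∈ Finset.range N,
        ((w ^ ((p : ℤ) - q) : Circle) : ℂ) * fourier (T := T) ((p : ℤ) - q) x := by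
  rw [Complex.ofReal_pow, ← Complex.mul_conj', map_sum, Finset.sum_mul_sum]
  refine Finset.sum_congr rfl fun p _ => Finset.sum_congr rfl fun q _ => ?_
  rw [map_mul, ← fourier_neg, sub_eq_add_neg, fourier_add, zpow_add, zpow_neg, Circle.coe_mul,
    Circle.coe_inv_eq_conj, zpow_natCast, zpow_natCast]
  ring

variable [hT : Fact (0 < T)]

theorem integral_sq_norm_sum_fourier (w : Circle) (N : ℕ) :
    ∫ x, ‖∑ p ∈ Finset.range N, ((w ^ p : Circle) : ℂ) * fourier (T := T) p x‖ ^ 2 ∂haarAddCircle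
      = N := by
  set E : C(AddCircle T, ℂ) := ∑ p ∈ Finset.range N, ((w ^ p : Circle) : ℂ) • fourier (p : ℤ)
    with hE
  have hEx : ∀ x, E x = ∑ p ∈ Finset.range N, ((w ^ p : Circle) : ℂ) * fourier (T := T) p x :=
    fun x => by simp [hE, -fourier_apply]
  simp_rw [← hEx]
  have h := hasSum_sq_fourierCoeff (ContinuousMap.toLp (E := ℂ) 2 haarAddCircle ℂ E)
  simp_rw [fourierCoeff_toLp] at h
  have hc : ∀ n : ℤ, fourierCoeff E n =
      ∑ p ∈ Finset.range N, ((w ^ p : Circle) : ℂ) * (Pi.single (p : ℤ) (1 : ℂ) : ℤ → ℂ) n := by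
    intro n
    rw [← fourierCoeffCLM_apply, hE, map_sum]
    refine Finset.sum_congr rfl fun p _ => ?_
    rw [map_smul, fourierCoeffCLM_apply, fourierCoeff_fourier, smul_eq_mul]
  have h2 : HasSum (fun n : ℤ => ‖fourierCoeff E n‖ ^ 2)
      (∑ n ∈ (Finset.range N).map Nat.castEmbedding, ‖fourierCoeff E n‖ ^ 2) := by
    refine hasSum_sum_of_ne_finset_zero fun n hn => ?_
    rw [hc, Finset.sum_eq_zero, norm_zero, zero_pow two_ne_zero]
    intro p hp
    rw [Pi.single_eq_of_ne, mul_zero]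
    rintro rfl
    exact hn (Finset.mem_map_of_mem Nat.castEmbedding hp)
  rw [Finset.sum_map] at h2
  have h3 : ∑ n ∈ Finset.range N, ‖fourierCoeff E (Nat.castEmbedding n)‖ ^ 2 = N := by
    rw [Finset.sum_congr rfl (g := fun _ => (1 : ℝ)), Finset.sum_const, Finset.card_range,
      nsmul_one]
    intro n hn
    rw [hc, Finset.sum_eq_single n]
    · rw [Nat.castEmbedding_apply, Pi.single_eq_same, mul_one, Circle.norm_coe, one_pow]
    · intro p _ hne
      rw [Pi.single_eq_of_ne (by simpa using hne.symm), mul_zero]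
    · exact fun h => absurd hn h
  rw [h3] at h2
  rw [h2.unique h]
  refine integral_congr_ae ?_
  filter_upwards [ContinuousMap.coeFn_toLp (p := 2) haarAddCircle (𝕜 := ℂ) E] with x hx
  rw [hx]

variable {ι : Type*} [Countable ι]

variable (T) in
/-- The trigonometric polynomial with coefficients `(1 - |m| / N) φ m`. -/
noncomputable def fejerMean (φ : ℤ → ℂ) (N : ℕ) : C(AddCircle T, ℂ) :=
  (N : ℂ)⁻¹ • ∑ p ∈ Finset.range N, ∑ q ∈ Finset.range N, φ ((p : ℤ) - q) • fourier ((p : ℤ) - q)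

/-- φ is the Fourier transform of the measure with masses `g j` at the points `w j`, so its Fejér
mean is a combination, with coefficients `g j`, of translated Fejér kernels, which are nonnegative
with integral 1. -/
theorem integral_norm_fejerMean_le {g : ι → ℂ} (hg : Summable fun j => ‖g j‖) (w : ι → Circle)
    {φ : ℤ → ℂ} (hφ : ∀ m, HasSum (fun j => g j * ((w j ^ m : Circle) : ℂ)) (φ m)) {N : ℕ}
    (hN : 0 < N) : ∫ x, ‖fejerMean T φ N x‖ ∂haarAddCircle ≤ ∑' j, ‖g j‖ := by
  have hN' : (0 : ℝ) < N := by exact_mod_cast hN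
  let k : ι → AddCircle T → ℝ := fun j x =>
    (N : ℝ)⁻¹ * ‖∑ p ∈ Finset.range N, ((w j ^ p : Circle) : ℂ) * fourier (T := T) p x‖ ^ 2
  have hk0 : ∀ j x, 0 ≤ k j x := fun j x => by positivity
  have hkc : ∀ j, Continuous (k j) := fun j => by
    refine continuous_const.mul (Continuous.pow (Continuous.norm ?_) 2)
    exact continuous_finsetSum _ fun p _ => continuous_const.mul (fourier _).continuous
  have hkint : ∀ j, ∫ x, k j x ∂haarAddCircle = 1 := fun j => by
    rw [integral_const_mul, integral_sq_norm_sum_fourier, inv_mul_cancel₀ hN'.ne']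
  have hklint : ∀ j, ∫⁻ x, ENNReal.ofReal (k j x) ∂haarAddCircle = 1 := fun j => by
    rw [← ofReal_integral_eq_lintegral_ofReal (integrable_haarAddCircle_of_continuous (hkc j))
      (.of_forall (hk0 j)), hkint, ENNReal.ofReal_one]
  have hsum : ∀ x, HasSum (fun j => g j * (k j x : ℂ)) (fejerMean T φ N x) := by
    intro x
    have h1 : HasSum (fun j => (N : ℂ)⁻¹ * ∑ p ∈ Finset.range N, ∑ q ∈ Finset.range N,
        g j * ((w j ^ ((p : ℤ) - q) : Circle) : ℂ) * fourier (T := T) ((p : ℤ) - q) x)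
        ((N : ℂ)⁻¹ * ∑ p ∈ Finset.range N, ∑ q ∈ Finset.range N,
          φ ((p : ℤ) - q) * fourier (T := T) ((p : ℤ) - q) x) :=
      (hasSum_sum fun p _ => hasSum_sum fun q _ => (hφ _).mul_right _).mul_left _
    convert h1 using 1
    · ext j
      simp only [k]
      rw [Complex.ofReal_mul, sq_norm_sum_fourier, mul_left_comm, Finset.mul_sum]
      simp_rw [Finset.mul_sum, mul_assoc]
      simp
    · simp [fejerMean, -fourier_apply]
  have hle : ∀ x, ‖fejerMean T φ N x‖ₑ ≤ ∑' j, ‖g j‖ₑ * ENNReal.ofReal (k j x) := fun x => by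
    rw [← (hsum x).tsum_eq]
    refine enorm_tsum_le_tsum_enorm.trans_eq (tsum_congr fun j => ?_)
    rw [enorm_mul]
    congr 1
    rw [← ofReal_norm, Complex.norm_real, Real.norm_of_nonneg (hk0 j x)]
  have hg' : ∑' j, ‖g j‖ₑ = ENNReal.ofReal (∑' j, ‖g j‖) := by
    rw [ENNReal.ofReal_tsum_of_nonneg (fun _ => norm_nonneg _) hg]
    simp_rw [ofReal_norm]
  rw [integral_norm_eq_lintegral_enorm (fejerMean T φ N).continuous.aestronglyMeasurable]
  refine ENNReal.toReal_le_of_le_ofReal (tsum_nonneg fun _ => norm_nonneg _) ?_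
  rw [← hg']
  calc _ ≤ ∫⁻ x, ∑' j, ‖g j‖ₑ * ENNReal.ofReal (k j x) ∂haarAddCircle := lintegral_mono hle
    _ = ∑' j, ∫⁻ x, ‖g j‖ₑ * ENNReal.ofReal (k j x) ∂haarAddCircle :=
        lintegral_tsum fun j => ((hkc j).measurable.ennreal_ofReal.const_mul _).aemeasurable
    _ = _ := tsum_congr fun j => by
        rw [lintegral_const_mul _ (hkc j).measurable.ennreal_ofReal, hklint, mul_one]

theorem fejerMean_mem_discAlgebra {φ : ℤ → ℂ} {N : ℕ} (h0 : ∀ m : ℤ, -N < m → m ≤ 0 → φ m = 0) :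
    fejerMean T φ N ∈ discAlgebra T := by
  refine Subalgebra.smul_mem _ (sum_mem fun p hp => sum_mem fun q hq => ?_) _
  rw [Finset.mem_range] at hp hq
  dsimp only
  rcases le_or_gt p q with h | h
  · rw [h0 _ (by omega) (by omega), zero_smul]
    exact zero_mem _
  · rw [← Nat.cast_sub h.le]
    exact Subalgebra.smul_mem _ (fourier_natCast_mem_discAlgebra _) _

theorem fourierCoeff_fejerMean (φ : ℤ → ℂ) {N n : ℕ} (hn : n < N) :
    fourierCoeff (fejerMean T φ N) n = (1 - (n : ℂ) / N) * φ n := by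
  have hN : (N : ℂ) ≠ 0 := by exact_mod_cast (by omega : N ≠ 0)
  have hrow : ∀ q ∈ Finset.range N, ∑ p ∈ Finset.range N,
      φ ((p : ℤ) - q) * (Pi.single ((p : ℤ) - q) (1 : ℂ) : ℤ → ℂ) n =
        if q ∈ Finset.range (N - n) then φ n else 0 := by
    intro q hq
    rw [Finset.mem_range] at hq
    split_ifs with h
    · rw [Finset.mem_range] at h
      rw [Finset.sum_eq_single (q + n)]
      · simp
      · intro p _ hne
        rw [Pi.single_eq_of_ne (by omega), mul_zero]
      · intro h'
        exact absurd (Finset.mem_range.2 (by omega)) h'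
    · rw [Finset.mem_range] at h
      refine Finset.sum_eq_zero fun p hp => ?_
      rw [Finset.mem_range] at hp
      rw [Pi.single_eq_of_ne (by omega), mul_zero]
  rw [← fourierCoeffCLM_apply, fejerMean, map_smul, map_sum]
  simp_rw [map_sum, map_smul, fourierCoeffCLM_apply, fourierCoeff_fourier, smul_eq_mul]
  rw [Finset.sum_comm, Finset.sum_congr rfl hrow, Finset.sum_ite_mem,
    Finset.inter_eq_right.2 (Finset.range_mono (Nat.sub_le _ _)), Finset.sum_const,
    Finset.card_range, nsmul_eq_mul, Nat.cast_sub hn.le]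
  field_simp

theorem sum_norm_div_le_of_vanishing {g : ι → ℂ} (hg : Summable fun j => ‖g j‖) (w : ι → Circle)
    {φ : ℤ → ℂ} (hφ : ∀ m, HasSum (fun j => g j * ((w j ^ m : Circle) : ℂ)) (φ m)) {N : ℕ}
    (hN : 0 < N) (h0 : ∀ m : ℤ, -N < m → m ≤ 0 → φ m = 0) :
    ∑ n ∈ Finset.range N, (1 - (n : ℝ) / N) * ‖φ n‖ / ((n : ℝ) + 1) ≤
      8 * Real.exp 1 * ∑' j, ‖g j‖ := by
  -- Any period would do: the measure is normalized and the frequencies sit in `w`.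
  have : Fact ((0 : ℝ) < 1) := ⟨one_pos⟩
  refine le_trans (Finset.sum_le_sum fun n hn => ?_)
    ((hardy_inequality (T := 1) (fejerMean_mem_discAlgebra h0) N).trans
      (mul_le_mul_of_nonneg_left (integral_norm_fejerMean_le hg w hφ hN) (by positivity)))
  have hn' := Finset.mem_range.1 hn
  rw [fourierCoeff_fejerMean φ hn', norm_mul]
  gcongr
  rw [show (1 - (n : ℂ) / N) = ((1 - (n : ℝ) / N : ℝ) : ℂ) by push_cast; rfl, Complex.norm_real]
  exact le_abs_self _

theorem lintegral_step_le (F : ℝ → ℂ) {L : ℝ} (hL : 0 < L) (K : ℕ) :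
    ∫⁻ s in Set.Ioc 0 ((K : ℝ) / L),
        ENNReal.ofReal (‖F (⌈s * L⌉₊ / L)‖ * (L / (⌈s * L⌉₊ + 1))) ≤
      ENNReal.ofReal (∑ m ∈ Finset.range K, ‖F ((m + 1 : ℕ) / L)‖ / ((m + 1 : ℕ) + 1)) := by
  induction K with
  | zero => simp
  | succ K ih =>
    have hunion : Set.Ioc 0 (((K + 1 : ℕ) : ℝ) / L) ⊆
        Set.Ioc 0 ((K : ℝ) / L) ∪ Set.Ioc ((K : ℝ) / L) (((K + 1 : ℕ) : ℝ) / L) := by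
      intro s hs
      rcases le_or_gt s (K / L) with h | h
      · exact .inl ⟨hs.1, h⟩
      · exact .inr ⟨h, hs.2⟩
    have hlast : ∫⁻ s in Set.Ioc ((K : ℝ) / L) (((K + 1 : ℕ) : ℝ) / L),
        ENNReal.ofReal (‖F (⌈s * L⌉₊ / L)‖ * (L / (⌈s * L⌉₊ + 1))) =
        ENNReal.ofReal (‖F ((K + 1 : ℕ) / L)‖ / ((K + 1 : ℕ) + 1)) := by
      rw [setLIntegral_congr_fun (g := fun _ => ENNReal.ofReal
        (‖F ((K + 1 : ℕ) / L)‖ * (L / ((K + 1 : ℕ) + 1)))) measurableSet_Ioc]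
      · rw [setLIntegral_const, Real.volume_Ioc, ← ENNReal.ofReal_mul (by positivity)]
        congr 1
        push_cast
        field_simp
        ring
      · intro s hs
        have : ⌈s * L⌉₊ = K + 1 := by
          rw [Nat.ceil_eq_iff (by omega)]
          exact ⟨by simpa using (div_lt_iff₀ hL).1 hs.1, (le_div_iff₀ hL).1 hs.2⟩
        simp only [this]
    rw [Finset.sum_range_succ, ENNReal.ofReal_add (Finset.sum_nonneg fun _ _ => by positivity)
      (by positivity), ← hlast]
    exact (lintegral_mono_set hunion).trans ((lintegral_union_le _ _ _).trans (by gcongr))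

/-- Fatou for step functions of mesh 1/L with L = N = 2(M + 1). On s ≤ 1/2 the Fejér weight 1 - n/N
is at least 1/2, whence the bound 2C. -/
theorem lintegral_div_lt_top_of_sum_le {F : ℝ → ℂ} (hF : Continuous F) {C : ℝ}
    (h : ∀ N : ℕ, 0 < N →
      ∑ n ∈ Finset.range N, (1 - (n : ℝ) / N) * ‖F (n / N)‖ / ((n : ℝ) + 1) ≤ C) :
    ∫⁻ s in Set.Ioc 0 (1 / 2), ENNReal.ofReal (‖F s‖ / s) < ⊤ := by
  let L : ℕ → ℝ := fun M => 2 * ((M : ℝ) + 1)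
  have hL : ∀ M, 0 < L M := fun M => by positivity
  let u : ℕ → ℝ → ENNReal := fun M s =>
    ENNReal.ofReal (‖F (⌈s * L M⌉₊ / L M)‖ * (L M / (⌈s * L M⌉₊ + 1)))
  have hLtop : Tendsto L atTop atTop :=
    (tendsto_natCast_atTop_atTop.atTop_add tendsto_const_nhds).const_mul_atTop two_pos
  have hlim : ∀ s, 0 < s → Tendsto (fun M => u M s) atTop (𝓝 (ENNReal.ofReal (‖F s‖ / s))) := by
    intro s hs
    have h1 : Tendsto (fun M => (⌈s * L M⌉₊ : ℝ) / L M) atTop (𝓝 s) :=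
      (tendsto_nat_ceil_mul_div_atTop hs.le).comp hLtop
    have h2 : Tendsto (fun M => L M / (⌈s * L M⌉₊ + 1)) atTop (𝓝 s⁻¹) := by
      have h3 : Tendsto (fun M => ((⌈s * L M⌉₊ : ℝ) / L M + (L M)⁻¹)⁻¹) atTop (𝓝 s⁻¹) := by
        have := (h1.add (tendsto_inv_atTop_zero.comp hLtop)).inv₀ (by simpa using hs.ne')
        simpa using this
      refine h3.congr fun M => ?_
      have := hL M
      field_simp
    exact (ENNReal.continuous_ofReal.tendsto _).comp
      (((hF.norm.tendsto _).comp h1).mul h2)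
  have hmeas : ∀ M, Measurable (u M) := fun M => by
    have hc : Measurable fun s : ℝ => (⌈s * L M⌉₊ : ℝ) :=
      measurable_from_nat.comp (Nat.measurable_ceil.comp (measurable_id.mul_const _))
    exact (((hF.measurable.comp (hc.div_const _)).norm).mul
      ((hc.add_const _).const_div _)).ennreal_ofReal
  have hbound : ∀ M, ∫⁻ s in Set.Ioc 0 (1 / 2), u M s ≤ ENNReal.ofReal (2 * C) := by
    intro M
    have hset : (1 / 2 : ℝ) = ((M + 1 : ℕ) : ℝ) / L M := by
      simp only [L]
      push_cast
      field_simp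
    rw [hset]
    refine (lintegral_step_le F (hL M) (M + 1)).trans (ENNReal.ofReal_le_ofReal ?_)
    have hN := h (2 * (M + 1)) (by omega)
    have hcast : ((2 * (M + 1) : ℕ) : ℝ) = L M := by simp [L]
    rw [hcast] at hN
    have hterm : ∀ n ∈ Finset.range (2 * (M + 1)),
        0 ≤ (1 - (n : ℝ) / L M) * ‖F (n / L M)‖ / ((n : ℝ) + 1) := by
      intro n hn
      have : (n : ℝ) / L M ≤ 1 := by
        rw [div_le_one (hL M), ← hcast]
        exact_mod_cast (Finset.mem_range.1 hn).le
      have : 0 ≤ 1 - (n : ℝ) / L M := by linarith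
      positivity
    have hinj : ∑ m ∈ Finset.range (M + 1),
        (1 - ((m + 1 : ℕ) : ℝ) / L M) * ‖F ((m + 1 : ℕ) / L M)‖ / (((m + 1 : ℕ) : ℝ) + 1) ≤
        ∑ n ∈ Finset.range (2 * (M + 1)), (1 - (n : ℝ) / L M) * ‖F (n / L M)‖ / ((n : ℝ) + 1) := by
      rw [← Finset.sum_image (s := Finset.range (M + 1)) (g := fun m => m + 1)
        (f := fun n : ℕ => (1 - (n : ℝ) / L M) * ‖F (n / L M)‖ / ((n : ℝ) + 1))
        (fun a _ b _ hab => by simpa using hab)]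
      refine Finset.sum_le_sum_of_subset_of_nonneg ?_ fun n hn _ => ?_
      · intro n hn
        obtain ⟨m, hm, rfl⟩ := Finset.mem_image.1 hn
        rw [Finset.mem_range] at hm ⊢
        omega
      · exact hterm n hn
    refine le_trans ?_ (mul_le_mul_of_nonneg_left (hinj.trans hN) two_pos.le)
    rw [Finset.mul_sum]
    refine Finset.sum_le_sum fun m hm => ?_
    have h1 : ((m + 1 : ℕ) : ℝ) / L M ≤ 1 / 2 := by
      rw [hset]
      have := hL M
      gcongr
      exact Nat.le_of_lt_succ (Finset.mem_range.1 hm)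
    rw [mul_div_assoc, ← mul_assoc]
    exact le_mul_of_one_le_left (by positivity) (by linarith)
  calc ∫⁻ s in Set.Ioc 0 (1 / 2), ENNReal.ofReal (‖F s‖ / s)
      = ∫⁻ s in Set.Ioc 0 (1 / 2), liminf (fun M => u M s) atTop :=
        setLIntegral_congr_fun measurableSet_Ioc fun s hs => (hlim s hs.1).liminf_eq.symm
    _ ≤ liminf (fun M => ∫⁻ s in Set.Ioc 0 (1 / 2), u M s) atTop := lintegral_liminf_le hmeas
    _ ≤ liminf (fun _ : ℕ => ENNReal.ofReal (2 * C)) atTop :=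
        liminf_le_liminf (.of_forall hbound)
    _ < ⊤ := by
      rw [liminf_const]
      exact ENNReal.ofReal_lt_top

/-- An absolutely convergent sum of exponentials vanishing on `(-1, 0]` is integrable against
`ds / s` to the right of the origin. -/
theorem lintegral_div_lt_top_of_vanishing {g : ι → ℂ} (hg : Summable fun j => ‖g j‖) (l : ι → ℝ)
    {F : ℝ → ℂ} (hF : ∀ s, HasSum (fun j => g j * Complex.exp ((l j * s : ℝ) * Complex.I)) (F s))
    (h0 : ∀ s, -1 < s → s ≤ 0 → F s = 0) :
    ∫⁻ s in Set.Ioc 0 (1 / 2), ENNReal.ofReal (‖F s‖ / s) < ⊤ := by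
  have hcont : Continuous F := by
    rw [show F = fun s => ∑' j, g j * Complex.exp ((l j * s : ℝ) * Complex.I) from
      funext fun s => (hF s).tsum_eq.symm]
    refine continuous_tsum (fun j => by fun_prop) hg fun j s => ?_
    rw [norm_mul, Complex.norm_exp_ofReal_mul_I, mul_one]
  refine lintegral_div_lt_top_of_sum_le hcont (C := 8 * Real.exp 1 * ∑' j, ‖g j‖) fun N hN => ?_
  have hN' : (0 : ℝ) < N := by exact_mod_cast hN
  -- At s = m/N the exponential of frequency `l j` is the m-th power of exp(i l_j / N).
  refine sum_norm_div_le_of_vanishing hg (fun j => Circle.exp (l j / N))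
    (φ := fun m => F (m / N)) (fun m => ?_) hN fun m hm hm0 => ?_
  · convert hF (m / N) using 3 with j
    rw [← Circle.exp_zsmul, Circle.coe_exp]
    congr 2
    simp
    ring
  · refine h0 _ ?_ ?_
    · rw [lt_div_iff₀ hN']
      have : ((-N : ℤ) : ℝ) < m := by exact_mod_cast hm
      push_cast at this
      linarith
    · exact div_nonpos_of_nonpos_of_nonneg (by exact_mod_cast hm0) hN'.le

end Sampling

/-! ### Telescoping of null-sequences. -/

theorem sum_Icc_neg_succ_sub {E : Type*} [AddCommGroup E] (u : ℤ → E) (N : ℕ) :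
    ∑ k ∈ Finset.Icc (-(N : ℤ)) N, (u (k + 1) - u k) = u (N + 1) - u (-N) := by
  induction N with
  | zero => simp
  | succ N ih =>
    push_cast
    rw [Finset.Icc_succ_succ, Finset.sum_union (by simp), Finset.sum_pair (by omega), ih,
      show -((N : ℤ) + 1) + 1 = -N by ring]
    abel

theorem IsNullSeq.tendsto_natCast_succ {c : ℤ → ℂ} (hc : IsNullSeq c) :
    Tendsto (fun N : ℕ => c ((N : ℤ) + 1)) atTop (𝓝 0) := by
  rw [← Nat.cofinite_eq_atTop]
  exact hc.comp (Function.Injective.tendsto_cofinite fun a b h => by simpa using h)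

theorem IsNullSeq.tendsto_neg_natCast {c : ℤ → ℂ} (hc : IsNullSeq c) :
    Tendsto (fun N : ℕ => c (-(N : ℤ))) atTop (𝓝 0) := by
  rw [← Nat.cofinite_eq_atTop]
  exact hc.comp (Function.Injective.tendsto_cofinite fun a b h => by simpa using h)

theorem IsNullSeq.hasSum_sub_zero {c : ℤ → ℂ} (hc : IsNullSeq c)
    (hd : Summable fun k => c (k + 1) - c k) : HasSum (fun k => c (k + 1) - c k) 0 := by
  obtain ⟨S, hS⟩ := hd
  have h1 := hS.comp (Finset.tendsto_Icc_neg (R := ℤ))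
  have h2 : Tendsto (fun N : ℕ => c ((N : ℤ) + 1) - c (-N)) atTop (𝓝 0) := by
    simpa using hc.tendsto_natCast_succ.sub hc.tendsto_neg_natCast
  have h3 : S = 0 := tendsto_nhds_unique (h1.congr fun N => sum_Icc_neg_succ_sub c N) h2
  rwa [h3] at hS

/-! ### The discrete Hilbert transform as multiplication by a square wave. -/

section Circle

open MeasureTheory AddCircle

/-- Riemann–Lebesgue on the line for f cut off to one period, at the frequencies n/T. -/
theorem tendsto_fourierCoeff_cofinite {T : ℝ} [hT : Fact (0 < T)] (f : AddCircle T → ℂ) :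
    Tendsto (fourierCoeff f) cofinite (𝓝 0) := by
  have h := (Real.tendsto_integral_exp_smul_cocompact
    ((Set.Ioc 0 (0 + T)).indicator fun x : ℝ => f x)).comp
    (Int.tendsto_zmultiplesHom_cofinite (inv_ne_zero hT.out.ne'))
  have h2 := h.const_smul (1 / T)
  rw [smul_zero] at h2
  refine h2.congr fun n => ?_
  rw [fourierCoeff_eq_intervalIntegral f n 0, intervalIntegral.integral_of_le (by linarith [hT.out]),
    ← integral_indicator measurableSet_Ioc]
  congr 1
  refine integral_congr_ae (.of_forall fun x => ?_)
  simp only [zmultiplesHom_apply]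
  by_cases hx : x ∈ Set.Ioc 0 (0 + T)
  · rw [Set.indicator_of_mem hx, Set.indicator_of_mem hx, fourier_coe_apply, Circle.smul_def,
      Real.fourierChar_apply]
    congr 2
    have := hT.out.ne'
    push_cast
    simp
    field_simp
  · rw [Set.indicator_of_notMem hx, Set.indicator_of_notMem hx, smul_zero]

theorem fourierCoeff_of_hasSum {T : ℝ} [hT : Fact (0 < T)] {d : ℤ → ℂ} {D : C(AddCircle T, ℂ)}
    (hD : HasSum (fun k => d k • fourier k) D) (n : ℤ) : fourierCoeff D n = d n := by
  have h := (fourierCoeffCLM n).hasSum hD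
  simp_rw [map_smul, fourierCoeffCLM_apply, fourierCoeff_fourier] at h
  refine h.unique ?_
  convert hasSum_single (f := fun k => d k • (Pi.single k (1 : ℂ) : ℤ → ℂ) n) n fun k hk => ?_
  · simp
  · rw [Pi.single_eq_of_ne hk.symm, smul_zero]

theorem fourier_two_pi_apply (n : ℤ) (t : ℝ) :
    fourier n (t : AddCircle (2 * Real.pi)) = Complex.exp ((n * t : ℝ) * Complex.I) := by
  rw [fourier_coe_apply]
  congr 1
  have : (Real.pi : ℂ) ≠ 0 := by exact_mod_cast Real.pi_ne_zero
  push_cast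
  field_simp

theorem integral_exp_half_integer (a : ℤ) :
    ∫ t in (0 : ℝ)..2 * Real.pi, Complex.exp (-(a + 1 / 2 : ℂ) * Complex.I * t) =
      2 / ((a + 1 / 2 : ℂ) * Complex.I) := by
  have ha : (a + 1 / 2 : ℂ) ≠ 0 := by
    intro h
    have h2 : ((2 * a + 1 : ℤ) : ℂ) = 0 := by push_cast; linear_combination 2 * h
    have : 2 * a + 1 = 0 := by exact_mod_cast h2
    omega
  have hc : -(a + 1 / 2 : ℂ) * Complex.I ≠ 0 := mul_ne_zero (neg_ne_zero.2 ha) Complex.I_ne_zero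
  rw [integral_exp_mul_complex hc]
  have h1 : Complex.exp (-(a + 1 / 2 : ℂ) * Complex.I * (2 * Real.pi : ℝ)) = -1 := by
    rw [show -(a + 1 / 2 : ℂ) * Complex.I * (2 * Real.pi : ℝ) =
      (-a : ℤ) * (2 * Real.pi * Complex.I) - Real.pi * Complex.I by push_cast; ring,
      Complex.exp_sub, Complex.exp_int_mul_two_pi_mul_I, Complex.exp_pi_mul_I]
    norm_num
  rw [h1]
  have hI := Complex.I_ne_zero
  simp only [Complex.ofReal_zero, mul_zero, Complex.exp_zero]
  field_simp
  ring

variable [hT : Fact (0 < 2 * Real.pi)]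

/-- The square wave `i π sgn(t) exp (-i t / 2)` times `D`. -/
noncomputable def squareWaveMul (D : C(AddCircle (2 * Real.pi), ℂ)) :
    AddCircle (2 * Real.pi) → ℂ :=
  AddCircle.liftIco (2 * Real.pi) 0 fun t : ℝ =>
    Real.pi * Complex.I * Complex.exp ((-t / 2 : ℝ) * Complex.I) * D t

theorem squareWaveMul_of_mem {D : C(AddCircle (2 * Real.pi), ℂ)} {t : ℝ}
    (ht : t ∈ Set.Ico 0 (2 * Real.pi)) : squareWaveMul D t =
      Real.pi * Complex.I * Complex.exp ((-t / 2 : ℝ) * Complex.I) * D t :=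
  AddCircle.liftIco_zero_coe_apply ht

/-- Translation by 2π changes the sign of e^{-it/2}; this produces the factor sgn(t). -/
theorem squareWaveMul_of_mem_neg {D : C(AddCircle (2 * Real.pi), ℂ)} {t : ℝ}
    (ht : t ∈ Set.Ico (-(2 * Real.pi)) 0) : squareWaveMul D t =
      -(Real.pi * Complex.I * Complex.exp ((-t / 2 : ℝ) * Complex.I) * D t) := by
  have h := squareWaveMul_of_mem (D := D) (t := t + 2 * Real.pi)
    ⟨by linarith [ht.1], by linarith [ht.2]⟩
  rw [AddCircle.coe_add_period] at h
  rw [h, show ((-(t + 2 * Real.pi) / 2 : ℝ) : ℂ) * Complex.I =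
    (-t / 2 : ℝ) * Complex.I - Real.pi * Complex.I by push_cast; ring, Complex.exp_sub,
    Complex.exp_pi_mul_I]
  ring

/-- The only jump is at 0, where D vanishes. -/
theorem continuous_squareWaveMul {D : C(AddCircle (2 * Real.pi), ℂ)} (h0 : D 0 = 0) :
    Continuous (squareWaveMul D) := by
  refine AddCircle.liftIco_zero_continuous ?_ (Continuous.continuousOn ?_)
  · rw [AddCircle.coe_period]
    simp [h0]
  · have : Continuous fun t : ℝ => D (t : AddCircle (2 * Real.pi)) :=
      D.continuous.comp (AddCircle.continuous_mk' _)
    fun_prop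

/-- The kernel 1/(n + 1/2 - k) is the Fourier coefficient of index n - k of the square wave;
summability of d permits termwise integration. -/
theorem hasSum_fourierCoeff_squareWaveMul {d : ℤ → ℂ} (hd : Summable fun k => ‖d k‖)
    {D : C(AddCircle (2 * Real.pi), ℂ)} (hD : HasSum (fun k => d k • fourier k) D) (n : ℤ) :
    HasSum (fun k : ℤ => d k / ((n : ℂ) + 1 / 2 - k)) (fourierCoeff (squareWaveMul D) n) := by
  rw [fourierCoeff_eq_intervalIntegral _ n 0, zero_add]
  have hpi := Real.two_pi_pos
  have hDx : ∀ x, HasSum (fun k => d k * fourier k x) (D x) := fun x => by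
    simpa [-fourier_apply] using (ContinuousMap.evalCLM ℂ x).hasSum hD
  have h := intervalIntegral.hasSum_integral_of_dominated_convergence (μ := volume)
    (a := 0) (b := 2 * Real.pi)
    (F := fun (k : ℤ) (t : ℝ) => Real.pi * Complex.I * d k *
      Complex.exp (-(((n - k : ℤ) : ℂ) + 1 / 2) * Complex.I * t))
    (f := fun t : ℝ => fourier (-n) (t : AddCircle (2 * Real.pi)) •
      (Real.pi * Complex.I * Complex.exp ((-t / 2 : ℝ) * Complex.I) * D t))
    (fun k _ => Real.pi * ‖d k‖)
    (fun k => Continuous.aestronglyMeasurable (by fun_prop))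
    (fun k => .of_forall fun t _ => by
      have : -(((n - k : ℤ) : ℂ) + 1 / 2) * Complex.I * t =
        ((-((n - k : ℤ) + 1 / 2) * t : ℝ) : ℂ) * Complex.I := by push_cast; ring
      rw [this, norm_mul, Complex.norm_exp_ofReal_mul_I, norm_mul, norm_mul, Complex.norm_I,
        Complex.norm_real, Real.norm_of_nonneg Real.pi_pos.le]
      simp)
    (.of_forall fun _ _ => hd.mul_left _)
    intervalIntegrable_const
    (.of_forall fun t _ => by
      convert! (hDx t).mul_left (fourier (-n) (t : AddCircle (2 * Real.pi)) *
        (Real.pi * Complex.I * Complex.exp ((-t / 2 : ℝ) * Complex.I))) using 1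
      · ext k
        rw [show -(((n - k : ℤ) : ℂ) + 1 / 2) * Complex.I * t =
          (((-n : ℤ) : ℝ) * t : ℝ) * Complex.I + (-t / 2 : ℝ) * Complex.I +
            ((k : ℝ) * t : ℝ) * Complex.I by push_cast; ring, Complex.exp_add, Complex.exp_add,
          fourier_two_pi_apply, fourier_two_pi_apply]
        ring
      · rw [smul_eq_mul]
        ring)
  have h2 := h.const_smul (1 / (2 * Real.pi))
  convert! h2 using 1
  · ext k
    rw [intervalIntegral.integral_const_mul, integral_exp_half_integer, Complex.real_smul]
    have hpi' : (Real.pi : ℂ) ≠ 0 := by exact_mod_cast Real.pi_ne_zero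
    have hI := Complex.I_ne_zero
    push_cast
    rw [show (n : ℂ) - k + 1 / 2 = n + 1 / 2 - k by ring]
    field_simp
  · congr 1
    refine intervalIntegral.integral_congr_Ioo_of_le hpi.le fun t ht => ?_
    rw [squareWaveMul_of_mem ⟨ht.1.le, ht.2⟩]

theorem hasSum_squareWaveMul {d h : ℤ → ℂ} (hd : Summable fun k => ‖d k‖)
    {D : C(AddCircle (2 * Real.pi), ℂ)} (hD : HasSum (fun k => d k • fourier k) D) (h0 : D 0 = 0)
    (hh : HasDiscreteHilbertTransform d h) (hhs : Summable fun n => ‖h n‖)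
    (x : AddCircle (2 * Real.pi)) :
    HasSum (fun n => h n * fourier n x) (squareWaveMul D x) := by
  have hcoeff : ∀ n, fourierCoeff (squareWaveMul D) n = h n := fun n =>
    tendsto_nhds_unique ((hasSum_fourierCoeff_squareWaveMul hd hD n).comp
      (Finset.tendsto_Icc_neg (R := ℤ))) (hh n)
  have := has_pointwise_sum_fourier_series_of_summable
    (f := ⟨squareWaveMul D, continuous_squareWaveMul h0⟩)
    (by simpa only [ContinuousMap.coe_mk, funext hcoeff] using hhs.of_norm) x
  simpa only [ContinuousMap.coe_mk, hcoeff, smul_eq_mul] using this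

theorem lintegral_norm_div_lt_top {d h : ℤ → ℂ} (hd : Summable fun k => ‖d k‖)
    {D : C(AddCircle (2 * Real.pi), ℂ)} (hD : HasSum (fun k => d k • fourier k) D) (h0 : D 0 = 0)
    (hh : HasDiscreteHilbertTransform d h) (hhs : Summable fun n => ‖h n‖) (σ : ℝ)
    (hσ : σ = 1 ∨ σ = -1) :
    ∫⁻ s in Set.Ioc 0 (1 / 2), ENNReal.ofReal (‖D ((σ * s : ℝ) : AddCircle (2 * Real.pi))‖ / s)
      < ⊤ := by
  have hpi : (Real.pi : ℂ) ≠ 0 := by exact_mod_cast Real.pi_ne_zero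
  have hpi3 := Real.pi_gt_three
  have hDx : ∀ x, HasSum (fun k => d k * fourier k x) (D x) := fun x => by
    simpa [-fourier_apply] using (ContinuousMap.evalCLM ℂ x).hasSum hD
  -- Near 0, e^{it/2} S(t)/(iπ) = sgn(t) D(t), so F(s) = (1 + sgn s) D(σs). The sign σ selects the
  -- side of the origin.
  let F : ℝ → ℂ := fun s => D ((σ * s : ℝ) : AddCircle (2 * Real.pi)) +
    σ / (Real.pi * Complex.I) * Complex.exp ((σ * s / 2 : ℝ) * Complex.I) *
      squareWaveMul D ((σ * s : ℝ) : AddCircle (2 * Real.pi))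
  have hpos : ∀ t, 0 ≤ t → t < 1 → Complex.exp ((t / 2 : ℝ) * Complex.I) *
      squareWaveMul D (t : AddCircle (2 * Real.pi)) = Real.pi * Complex.I * D t := by
    intro t ht0 ht1
    rw [squareWaveMul_of_mem ⟨ht0, by linarith⟩,
      show ((-t / 2 : ℝ) : ℂ) * Complex.I = -((t / 2 : ℝ) * Complex.I) by push_cast; ring,
      Complex.exp_neg]
    field_simp [Complex.exp_ne_zero]
  have hneg : ∀ t, -1 < t → t < 0 → Complex.exp ((t / 2 : ℝ) * Complex.I) *
      squareWaveMul D (t : AddCircle (2 * Real.pi)) = -(Real.pi * Complex.I * D t) := by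
    intro t ht0 ht1
    rw [squareWaveMul_of_mem_neg ⟨by linarith, ht1⟩,
      show ((-t / 2 : ℝ) : ℂ) * Complex.I = -((t / 2 : ℝ) * Complex.I) by push_cast; ring,
      Complex.exp_neg]
    field_simp [Complex.exp_ne_zero]
  -- The left summand carries the integer frequencies of D; the factor e^{it/2} moves those of S to
  -- half-integers, carried by the right one.
  have hF : ∀ s, HasSum (fun j : ℤ ⊕ ℤ =>
      Sum.elim d (fun n => σ / (Real.pi * Complex.I) * h n) j *
        Complex.exp ((Sum.elim (fun k : ℤ => σ * k) (fun n : ℤ => σ * (n + 1 / 2)) j * s : ℝ) *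
          Complex.I)) (F s) := by
    intro s
    refine HasSum.sum ?_ ?_
    · convert! hDx ((σ * s : ℝ) : AddCircle (2 * Real.pi)) using 2 with k
      rw [fourier_two_pi_apply]
      simp only [Function.comp_apply, Sum.elim_inl]
      congr 2
      push_cast
      ring
    · convert! (hasSum_squareWaveMul hd hD h0 hh hhs
        ((σ * s : ℝ) : AddCircle (2 * Real.pi))).mul_left
        (σ / (Real.pi * Complex.I) * Complex.exp ((σ * s / 2 : ℝ) * Complex.I)) using 2 with n
      rw [fourier_two_pi_apply]
      simp only [Function.comp_apply, Sum.elim_inr]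
      rw [show ((σ * (n + 1 / 2) * s : ℝ) : ℂ) * Complex.I =
        (σ * s / 2 : ℝ) * Complex.I + (n * (σ * s) : ℝ) * Complex.I by push_cast; ring,
        Complex.exp_add]
      ring
  have hg : Summable fun j : ℤ ⊕ ℤ =>
      ‖Sum.elim d (fun n => σ / (Real.pi * Complex.I) * h n) j‖ := by
    refine Summable.sum _ hd ?_
    simpa only [Function.comp_def, Sum.elim_inr, norm_mul] using hhs.mul_left _
  have hI := Complex.I_ne_zero
  have hF0 : ∀ s, -1 < s → s ≤ 0 → F s = 0 := by
    intro s hs1 hs0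
    rcases hσ with rfl | rfl
    · rcases hs0.lt_or_eq with hs | rfl
      · simp only [F, one_mul]
        rw [mul_assoc, hneg s hs1 hs]
        field_simp
        simp
      · simp only [F, one_mul]
        rw [mul_assoc, hpos 0 le_rfl one_pos]
        simp [h0]
    · simp only [F]
      rw [mul_assoc, hpos (-1 * s) (by linarith) (by linarith)]
      push_cast
      field_simp
      simp
  have hF2 : ∀ s ∈ Set.Ioc (0 : ℝ) (1 / 2),
      F s = 2 * D ((σ * s : ℝ) : AddCircle (2 * Real.pi)) := by
    rintro s ⟨hs0, hs1⟩
    rcases hσ with rfl | rfl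
    · simp only [F]
      rw [mul_assoc, hpos (1 * s) (by linarith) (by linarith)]
      push_cast
      field_simp
      norm_num
    · simp only [F]
      rw [mul_assoc, hneg (-1 * s) (by linarith) (by linarith)]
      push_cast
      field_simp
      norm_num
  refine lt_of_le_of_lt (setLIntegral_mono' measurableSet_Ioc fun s hs => ?_)
    (lintegral_div_lt_top_of_vanishing hg _ hF hF0)
  rw [hF2 s hs, norm_mul]
  refine ENNReal.ofReal_le_ofReal ?_
  have := hs.1
  gcongr
  exact le_mul_of_one_le_left (norm_nonneg _) (by simp)

end Circle

/-! ### Division by e^{-it} - 1 and recovery of the coefficients. -/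

section DivByShift

open MeasureTheory AddCircle

theorem fourier_neg_one_ne_one {T : ℝ} (hT : T ≠ 0) {x : AddCircle T} (hx : x ≠ 0) :
    fourier (-1) x ≠ 1 := by
  intro h
  rw [fourier_neg, fourier_one] at h
  have h2 : (toCircle x : ℂ) = 1 := by simpa using congrArg (starRingEnd ℂ) h
  refine hx (AddCircle.injective_toCircle hT ?_)
  rw [toCircle_zero]
  exact Circle.ext (by simpa using h2)

/-- The norm is 2|sin(t/2)|; apply Jordan's inequality. -/
theorem abs_le_norm_fourier_neg_one_sub_one {t : ℝ} (ht : |t| ≤ Real.pi) :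
    2 / Real.pi * |t| ≤ ‖fourier (-1) (t : AddCircle (2 * Real.pi)) - 1‖ := by
  have h1 : ((((-1 : ℤ) : ℝ) * t : ℝ) : ℂ) * Complex.I = Complex.I * ((-t : ℝ) : ℂ) := by
    push_cast
    ring
  rw [fourier_two_pi_apply, h1, Complex.norm_exp_I_mul_ofReal_sub_one, norm_mul, Real.norm_eq_abs,
    Real.norm_eq_abs, abs_two, neg_div, Real.sin_neg, abs_neg]
  have h2 : |t / 2| = |t| / 2 := by rw [abs_div, abs_two]
  have := Real.mul_abs_le_abs_sin (x := t / 2) (by rw [h2]; linarith)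
  rw [h2] at this
  linarith

variable [hT : Fact (0 < 2 * Real.pi)]

theorem integrable_div_fourier_neg_one_sub_one {D : C(AddCircle (2 * Real.pi), ℂ)}
    (hD : ∀ σ : ℝ, σ = 1 ∨ σ = -1 → ∫⁻ s in Set.Ioc 0 (1 / 2),
      ENNReal.ofReal (‖D ((σ * s : ℝ) : AddCircle (2 * Real.pi))‖ / s) < ⊤) :
    Integrable (fun x => D x / (fourier (-1) x - 1)) haarAddCircle := by
  have hpi := Real.pi_pos
  have hm : Measurable fun x : AddCircle (2 * Real.pi) => D x / (fourier (-1) x - 1) :=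
    D.continuous.measurable.div ((fourier (-1)).continuous.measurable.sub_const 1)
  rw [← memLp_one_iff_integrable, memLp_haarAddCircle_iff, memLp_one_iff_integrable]
  refine ⟨hm.aestronglyMeasurable, ?_⟩
  rw [hasFiniteIntegral_iff_enorm, ← AddCircle.lintegral_preimage (2 * Real.pi) (-Real.pi)]
  -- A majorant for each side of the origin within distance 1/2; farther out the quotient is at most
  -- π‖D‖.
  let A : ℝ → ℝ → ENNReal := fun σ => (Set.Ioc 0 (1 / 2)).indicator fun s =>
    ENNReal.ofReal (Real.pi / 2) *
      ENNReal.ofReal (‖D ((σ * s : ℝ) : AddCircle (2 * Real.pi))‖ / s)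
  have hDm : ∀ σ : ℝ, Measurable fun s : ℝ =>
      ENNReal.ofReal (‖D ((σ * s : ℝ) : AddCircle (2 * Real.pi))‖ / s) := fun σ => by
    have : Continuous fun s : ℝ => D ((σ * s : ℝ) : AddCircle (2 * Real.pi)) :=
      D.continuous.comp ((AddCircle.continuous_mk' _).comp (continuous_const.mul continuous_id))
    exact (this.norm.measurable.div measurable_id).ennreal_ofReal
  have hAm : ∀ σ, Measurable (A σ) := fun σ =>
    ((hDm σ).const_mul _).indicator measurableSet_Ioc
  have hA : ∀ σ : ℝ, σ = 1 ∨ σ = -1 → ∫⁻ s, A σ s < ⊤ := fun σ hσ => by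
    simp only [A]
    rw [lintegral_indicator measurableSet_Ioc, lintegral_const_mul _ (hDm σ)]
    exact ENNReal.mul_lt_top ENNReal.ofReal_lt_top (hD σ hσ)
  have hbound : ∀ t ∈ Set.Ioc (-Real.pi) (-Real.pi + 2 * Real.pi),
      ‖D (t : AddCircle (2 * Real.pi)) / (fourier (-1) (t : AddCircle (2 * Real.pi)) - 1)‖ₑ ≤
        A 1 t + A (-1) (-t) + ENNReal.ofReal (Real.pi * ‖D‖) := by
    rintro t ⟨ht1, ht2⟩
    have hle : ‖D (t : AddCircle (2 * Real.pi)) /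
        (fourier (-1) (t : AddCircle (2 * Real.pi)) - 1)‖ ≤
        Real.pi / 2 * (‖D (t : AddCircle (2 * Real.pi))‖ / |t|) := by
      rcases eq_or_ne t 0 with rfl | ht0
      · simp
      · have h := abs_le_norm_fourier_neg_one_sub_one (t := t) (abs_le.2 ⟨ht1.le, by linarith⟩)
        have htp : 0 < |t| := abs_pos.2 ht0
        rw [norm_div]
        calc _ ≤ ‖D (t : AddCircle (2 * Real.pi))‖ / (2 / Real.pi * |t|) := by gcongr
          _ = _ := by field_simp
    rw [← ofReal_norm]
    refine (ENNReal.ofReal_le_ofReal hle).trans ?_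
    by_cases hp : t ∈ Set.Ioc (0 : ℝ) (1 / 2)
    · refine le_trans ?_ (le_self_add.trans le_self_add)
      simp only [A]
      rw [Set.indicator_of_mem hp, one_mul, ENNReal.ofReal_mul (by positivity), abs_of_pos hp.1]
    by_cases hn : -t ∈ Set.Ioc (0 : ℝ) (1 / 2)
    · refine le_trans ?_ (le_add_self.trans le_self_add)
      simp only [A]
      rw [Set.indicator_of_mem hn, neg_one_mul, neg_neg, ENNReal.ofReal_mul (by positivity),
        abs_of_neg (by linarith [hn.1])]
    · refine le_trans (ENNReal.ofReal_le_ofReal ?_) le_add_self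
      rcases eq_or_ne t 0 with rfl | ht0
      · simp
        positivity
      · have ht : 1 / 2 ≤ |t| := by
          by_contra! hlt
          rw [abs_lt] at hlt
          rcases lt_or_gt_of_ne ht0 with h | h
          · exact hn ⟨by linarith, by linarith⟩
          · exact hp ⟨h, by linarith⟩
        calc _ ≤ Real.pi / 2 * (‖D‖ / (1 / 2)) := by
              gcongr
              exact D.norm_coe_le_norm _
          _ = _ := by ring
  calc _ ≤ ∫⁻ t in Set.Ioc (-Real.pi) (-Real.pi + 2 * Real.pi),
        (A 1 t + A (-1) (-t) + ENNReal.ofReal (Real.pi * ‖D‖)) :=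
        setLIntegral_mono' measurableSet_Ioc hbound
    _ = (∫⁻ t in Set.Ioc (-Real.pi) (-Real.pi + 2 * Real.pi), A 1 t) +
        (∫⁻ t in Set.Ioc (-Real.pi) (-Real.pi + 2 * Real.pi), A (-1) (-t)) +
        ∫⁻ _ in Set.Ioc (-Real.pi) (-Real.pi + 2 * Real.pi), ENNReal.ofReal (Real.pi * ‖D‖) := by
        rw [lintegral_add_right _ measurable_const, lintegral_add_left (hAm 1)]
    _ < ⊤ := by
        refine ENNReal.add_lt_top.2 ⟨ENNReal.add_lt_top.2 ⟨?_, ?_⟩, ?_⟩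
        · exact (setLIntegral_le_lintegral _ _).trans_lt (hA 1 (.inl rfl))
        · refine (setLIntegral_le_lintegral _ _).trans_lt ?_
          rw [lintegral_neg_eq_self]
          exact hA (-1) (.inr rfl)
        · rw [setLIntegral_const, Real.volume_Ioc]
          exact ENNReal.mul_lt_top ENNReal.ofReal_lt_top ENNReal.ofReal_lt_top

/-- Case of a difference sequence whose discrete Hilbert transform is summable. -/
theorem IsNullSeq.isFourierSeries_of_summable {c h : ℤ → ℂ} (hnull : IsNullSeq c) (hbv : IsBV c)
    (hh : HasDiscreteHilbertTransform (fun k => c (k + 1) - c k) h)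
    (hhs : Summable fun n => ‖h n‖) : IsFourierSeries c := by
  have hd : Summable fun k : ℤ => ‖c (k + 1) - c k‖ := hbv.congr fun k => norm_sub_rev _ _
  obtain ⟨D, hD⟩ : Summable fun k : ℤ =>
      (c (k + 1) - c k) • (fourier k : C(AddCircle (2 * Real.pi), ℂ)) := by
    refine Summable.of_norm ?_
    simpa only [norm_smul, fourier_norm, mul_one] using hd
  have h0 : D 0 = 0 := by
    have h1 := (ContinuousMap.evalCLM ℂ (0 : AddCircle (2 * Real.pi))).hasSum hD
    refine HasSum.unique ?_ (hnull.hasSum_sub_zero hd.of_norm)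
    simpa [fourier_eval_zero, -fourier_apply] using h1
  have hint := integrable_div_fourier_neg_one_sub_one
    (lintegral_norm_div_lt_top hd hD h0 hh hhs)
  set f : AddCircle (2 * Real.pi) → ℂ := fun x => D x / (fourier (-1) x - 1) with hf
  -- At x = 0 the quotient is 0 by convention and D(0) = 0, so the identity holds there too.
  have hmul : (fun x => f x * fourier (-1) x) = f + ⇑D := by
    ext x
    rcases eq_or_ne x 0 with rfl | hx
    · simp [hf, h0]
    · have := sub_ne_zero.2 (fourier_neg_one_ne_one Real.two_pi_pos.ne' hx)
      simp only [hf, Pi.add_apply]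
      field_simp
      ring
  have hstep : ∀ k, fourierCoeff f (k + 1) - c (k + 1) = fourierCoeff f k - c k := fun k => by
    have h1 := fourierCoeff_mul_fourier f (-1) k
    rw [hmul, fourierCoeff.add hint (integrable_haarAddCircle_of_continuous D.continuous),
      Pi.add_apply, fourierCoeff_of_hasSum hD, sub_neg_eq_add] at h1
    rw [← h1]
    ring
  have hconst : ∀ k, fourierCoeff f k - c k = fourierCoeff f 0 - c 0 := fun k => by
    induction k using Int.induction_on with
    | zero => rfl
    | succ i ih => rw [hstep, ih]
    | pred i ih => rw [← ih, ← hstep, sub_add_cancel]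
  have hlim : Tendsto (fun k => fourierCoeff f k - c k) cofinite (𝓝 0) := by
    simpa using (tendsto_fourierCoeff_cofinite f).sub hnull
  have hzero : fourierCoeff f 0 - c 0 = 0 :=
    tendsto_nhds_unique (tendsto_const_nhds.congr fun k => (hconst k).symm) hlim
  exact ⟨f, hint, fun k => sub_eq_zero.1 ((hconst k).trans hzero)⟩

end DivByShift

/-! ### Differences under the discrete Hilbert transform, and the theorem. -/

theorem tendsto_norm_add_natCast_atTop (a : ℂ) :
    Tendsto (fun N : ℕ => ‖a + (N : ℂ)‖) atTop atTop := by
  refine tendsto_atTop_mono (fun N => ?_)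
    (tendsto_atTop_add_const_right _ (-‖a‖) tendsto_natCast_atTop_atTop)
  have := norm_sub_norm_le (N : ℂ) (-a)
  rw [norm_neg, sub_neg_eq_add, add_comm, Complex.norm_natCast] at this
  linarith

/-- The discrete Hilbert transform commutes with differences of null-sequences. -/
theorem HasDiscreteHilbertTransform.sub_shift {c h : ℤ → ℂ} (hnull : IsNullSeq c)
    (hh : HasDiscreteHilbertTransform c h) :
    HasDiscreteHilbertTransform (fun k => c (k + 1) - c k) fun n => h (n + 1) - h n := by
  intro n
  have hzero : ∀ {u : ℕ → ℂ} (a : ℂ), Tendsto u atTop (𝓝 0) →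
      Tendsto (fun N => u N / (a + N)) atTop (𝓝 0) := fun a hu => by
    have := hu.mul (tendsto_inv₀_cobounded.comp
      (tendsto_norm_atTop_iff_cobounded.1 (tendsto_norm_add_natCast_atTop a)))
    simpa [div_eq_mul_inv, Function.comp_def] using this
  -- The kernel depends only on n - k, so shifting c amounts to shifting n, up to these two
  -- vanishing boundary terms.
  have h1 := hzero (-((n : ℂ) + 1 / 2)) hnull.tendsto_natCast_succ
  have h2 := hzero ((n : ℂ) + 1 + 1 / 2) hnull.tendsto_neg_natCast
  have h3 := (((hh (n + 1)).sub h1).sub h2).sub (hh n)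
  simp only [sub_zero] at h3
  refine h3.congr fun N => ?_
  have htel := sum_Icc_neg_succ_sub (fun k => c k / (((n + 1 : ℤ) : ℂ) + 1 / 2 - k)) N
  rw [Finset.sum_sub_distrib] at htel
  simp_rw [sub_div]
  rw [Finset.sum_sub_distrib]
  congr 1
  have hshift : ∀ k ∈ Finset.Icc (-(N : ℤ)) N, c (k + 1) / ((n : ℂ) + 1 / 2 - k) =
      c (k + 1) / (((n + 1 : ℤ) : ℂ) + 1 / 2 - (k + 1 : ℤ)) := fun k _ => by
    congr 1
    push_cast
    ring
  rw [Finset.sum_congr rfl hshift, eq_add_of_sub_eq htel]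
  have e1 : c ((N : ℤ) + 1) / (((n + 1 : ℤ) : ℂ) + 1 / 2 - ((N + 1 : ℤ) : ℂ)) =
      -(c ((N : ℤ) + 1) / (-((n : ℂ) + 1 / 2) + N)) := by
    rw [← div_neg]
    congr 1
    push_cast
    ring
  have e2 : ((n + 1 : ℤ) : ℂ) + 1 / 2 - ((-N : ℤ) : ℂ) = (n : ℂ) + 1 + 1 / 2 + N := by
    push_cast
    ring
  rw [e1, e2]
  ring

theorem mainTheorem4 (c : ℤ → ℂ) (hnull : IsNullSeq c) (hbv : IsBV c) :
    ((∃ h : ℤ → ℂ, HasDiscreteHilbertTransform (fun k => c (k + 1) - c k) h ∧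
        Summable fun n : ℤ => ‖h n‖) → IsFourierSeries c) ∧
    ((∃ h : ℤ → ℂ, HasDiscreteHilbertTransform c h ∧ IsBV h) → IsFourierSeries c) := by
  have : Fact (0 < 2 * Real.pi) := ⟨Real.two_pi_pos⟩
  refine ⟨fun ⟨h, hh, hs⟩ => hnull.isFourierSeries_of_summable hbv hh hs, fun ⟨h, hh, hs⟩ => ?_⟩
  exact hnull.isFourierSeries_of_summable hbv (hh.sub_shift hnull)
    (hs.congr fun n => norm_sub_rev _ _)
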